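/- Let $n\ge 1$ and let $\mathbb{B}^n$ be the open unit ball of $\mathbb{C}^n$. Let $A(\mathbb{B}^n)$ be the ball algebra, i.e. the closure, in the supremum norm on $\mathbb{B}^n$, of the functions holomorphic in a neighbourhood of $\overline{\mathbb{B}^n}$, and let $H^\infty(\mathbb{B}^n)$ be the algebra of bounded holomorphic functions on $\mathbb{B}^n$. A quasi-free Hilbert module of multiplicity one over $A(\mathbb{B}^n)$ is a Hilbert space $\mathcal{R}$ that is a completion of $A(\mathbb{B}^n)$ with respect to some inner product norm, such that (1) multiplication by each $\varphi\in A(\mathbb{B}^n)$ defines a bounded operator on $\mathcal{R}$; (2) the evaluations $f\mapsto f(w)$, $w\in\mathbb{B}^n$, are bounded in the norm of $\mathcal{R}$, locally uniformly in $w$; (3) a sequence in $A(\mathbb{B}^n)$ that is Cauchy in the norm of $\mathcal{R}$ converges to $0$ in $\mathcal{R}$ if and only if it converges to $0$ at every point of $\mathbb{B}^n$. The elements of $\mathcal{R}$ are then holomorphic functions on $\mathbb{B}^n$. The module is contractive if $\|\varphi h\|_{\mathcal{R}}\le\|\varphi\|_\infty\|h\|_{\mathcal{R}}$ for all $\varphi\in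 A(\mathbb{B}^n)$ and $h\in\mathcal{R}$; in that case every $\varphi\in H^\infty(\mathbb{B}^n)$ defines a bounded multiplication operator $M_\varphi h=\varphi h$ on $\mathcal{R}$. Theorem. Let $\mathcal{R}$ be a contractive quasi-free Hilbert module of multiplicity one over $A(\mathbb{B}^n)$, and let $\varphi_1,\dots,\varphi_k\in H^\infty(\mathbb{B}^n)$. If the tuple $(M_{\varphi_1},\dots,M_{\varphi_k})$ is semi-Fredholm, that is, if $$\dim\big(\mathcal{R}/(M_{\varphi_1}\mathcal{R}+\cdots+M_{\varphi_k}\mathcal{R})\big)<\infty,$$ then $(\varphi_1,\dots,\varphi_k)$ has the weak corona property: there are $\varepsilon>0$ and $0<\delta<1$ such that $$\sum_{i=1}^k|\varphi_i(z)|^2\ge\varepsilon\qquad\text{for all } z\in\mathbb{B}^n \text{ with } 1-\delta\le\|z\|<1.$$ -/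

import Mathlib

open Filter Topology Metric
open scoped BoundedContinuousFunction ComplexConjugate

noncomputable section

/-- Complex `n`-space with its Euclidean norm. -/
abbrev CSpace (n : ℕ) : Type := EuclideanSpace ℂ (Fin n)

/-- The open unit ball of `ℂⁿ`. -/
abbrev unitBall (n : ℕ) : Set (CSpace n) := Metric.ball 0 1

/-- The functions on `Ω` that are restrictions of functions holomorphic in some neighbourhood of
the closure of `Ω` (and that are bounded on `Ω`). -/
def holoNearClosure {n : ℕ} (Ω : Set (CSpace n)) : Subalgebra ℂ (Ω →ᵇ ℂ) where
  carrier := {f | ∃ (U : Set (CSpace n)) (g : CSpace n → ℂ), IsOpen U ∧ closure Ω ⊆ U ∧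
    DifferentiableOn ℂ g U ∧ ∀ z : Ω, f z = g z}
  mul_mem' := by
    rintro f₁ f₂ ⟨U₁, g₁, hU₁, hc₁, hg₁, h₁⟩ ⟨U₂, g₂, hU₂, hc₂, hg₂, h₂⟩
    refine ⟨U₁ ∩ U₂, fun z => g₁ z * g₂ z, hU₁.inter hU₂, Set.subset_inter hc₁ hc₂,
      (hg₁.mono Set.inter_subset_left).mul (hg₂.mono Set.inter_subset_right), fun z => ?_⟩
    simp [h₁, h₂]
  add_mem' := by
    rintro f₁ f₂ ⟨U₁, g₁, hU₁, hc₁, hg₁, h₁⟩ ⟨U₂, g₂, hU₂, hc₂, hg₂, h₂⟩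
    refine ⟨U₁ ∩ U₂, fun z => g₁ z + g₂ z, hU₁.inter hU₂, Set.subset_inter hc₁ hc₂,
      (hg₁.mono Set.inter_subset_left).add (hg₂.mono Set.inter_subset_right), fun z => ?_⟩
    simp [h₁, h₂]
  algebraMap_mem' := by
    intro c
    exact ⟨Set.univ, fun _ => c, isOpen_univ, Set.subset_univ _, differentiableOn_const c,
      fun z => rfl⟩

/-- The algebra `A(Ω)`: the closure, in the supremum norm on `Ω`, of the functions holomorphic in
some neighbourhood of the closure of `Ω`. For the unit ball this is the ball algebra. -/
def holoAlgebra {n : ℕ} (Ω : Set (CSpace n)) : Subalgebra ℂ (Ω →ᵇ ℂ) :=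
  (holoNearClosure Ω).topologicalClosure

/-- The algebra `H^∞(Ω)` of bounded holomorphic functions on `Ω`. -/
def hInfty {n : ℕ} (Ω : Set (CSpace n)) : Subalgebra ℂ (Ω →ᵇ ℂ) where
  carrier := {f | ∃ g : CSpace n → ℂ, DifferentiableOn ℂ g Ω ∧ ∀ z : Ω, f z = g z}
  mul_mem' := by
    rintro f₁ f₂ ⟨g₁, hg₁, h₁⟩ ⟨g₂, hg₂, h₂⟩
    exact ⟨fun z => g₁ z * g₂ z, hg₁.mul hg₂, fun z => by simp [h₁, h₂]⟩
  add_mem' := by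
    rintro f₁ f₂ ⟨g₁, hg₁, h₁⟩ ⟨g₂, hg₂, h₂⟩
    exact ⟨fun z => g₁ z + g₂ z, hg₁.add hg₂, fun z => by simp [h₁, h₂]⟩
  algebraMap_mem' := by
    intro c
    exact ⟨fun _ => c, differentiableOn_const c, fun z => rfl⟩

/-- A quasi-free Hilbert module over `A(Ω)` of multiplicity (rank) one: a Hilbert space `H` that is
a completion of `A(Ω)` (embedded through `incl`), such that multiplication by functions of `A(Ω)`
is bounded, the evaluations are locally uniformly bounded, and a sequence in `A(Ω)` that is Cauchy
in the norm of `H` tends to `0` in `H` if and only if it tends to `0` pointwise on `Ω`. -/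
structure QuasiFreeModule {n : ℕ} (Ω : Set (CSpace n)) (H : Type*) [NormedAddCommGroup H]
    [InnerProductSpace ℂ H] [CompleteSpace H] where
  incl : holoAlgebra Ω →ₗ[ℂ] H
  incl_injective : Function.Injective incl
  denseRange_incl : DenseRange incl
  bounded_mul : ∀ φ : holoAlgebra Ω, ∃ C : ℝ, ∀ f : holoAlgebra Ω,
    ‖incl (φ * f)‖ ≤ C * ‖incl f‖
  locally_bounded_eval : ∀ w : Ω, ∃ U ∈ 𝓝 w, ∃ C : ℝ, ∀ z ∈ U, ∀ f : holoAlgebra Ω,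
    ‖(f : Ω →ᵇ ℂ) z‖ ≤ C * ‖incl f‖
  tendsto_zero_iff : ∀ f : ℕ → holoAlgebra Ω, CauchySeq (fun k => incl (f k)) →
    (Tendsto (fun k => incl (f k)) atTop (𝓝 0) ↔
      ∀ w : Ω, Tendsto (fun k => (f k : Ω →ᵇ ℂ) w) atTop (𝓝 0))

namespace QuasiFreeModule

variable {n : ℕ} {Ω : Set (CSpace n)} {H : Type*} [NormedAddCommGroup H]
  [InnerProductSpace ℂ H] [CompleteSpace H]

/-- The module multiplication by `φ ∈ A(Ω)`, extended from `A(Ω)` to its completion. -/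
def act (R : QuasiFreeModule Ω H) (φ : holoAlgebra Ω) : H →L[ℂ] H :=
  (R.incl ∘ₗ LinearMap.mulLeft ℂ φ).extendOfNorm R.incl

theorem act_incl (R : QuasiFreeModule Ω H) (φ f : holoAlgebra Ω) :
    R.act φ (R.incl f) = R.incl (φ * f) :=
  LinearMap.extendOfNorm_eq (f := R.incl ∘ₗ LinearMap.mulLeft ℂ φ) R.denseRange_incl
    (R.bounded_mul φ) f

/-- The module is contractive if `‖φ · h‖ ≤ ‖φ‖_∞ ‖h‖` for all `φ ∈ A(Ω)` and `h ∈ H`. -/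
def IsContractive (R : QuasiFreeModule Ω H) : Prop :=
  ∀ (φ : holoAlgebra Ω) (h : H), ‖R.act φ h‖ ≤ ‖φ‖ * ‖h‖

/-- The evaluation at `z ∈ Ω` as a linear functional on `A(Ω)`. -/
def evalLin (z : Ω) : holoAlgebra Ω →ₗ[ℂ] ℂ where
  toFun f := (f : Ω →ᵇ ℂ) z
  map_add' _ _ := rfl
  map_smul' _ _ := rfl

/-- The evaluation at `z ∈ Ω`, extended from `A(Ω)` to its completion. It makes the elements of
`H` functions on `Ω`. -/
def ev (R : QuasiFreeModule Ω H) (z : Ω) : H →L[ℂ] ℂ :=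
  (evalLin z).extendOfNorm R.incl

theorem ev_incl (R : QuasiFreeModule Ω H) (z : Ω) (f : holoAlgebra Ω) :
    R.ev z (R.incl f) = (f : Ω →ᵇ ℂ) z := by
  obtain ⟨U, hU, C, hC⟩ := R.locally_bounded_eval z
  exact LinearMap.extendOfNorm_eq (f := evalLin z) R.denseRange_incl
    ⟨C, fun f => hC z (mem_of_mem_nhds hU) f⟩ f

theorem ev_act (R : QuasiFreeModule Ω H) (φ : holoAlgebra Ω) (h : H) (z : Ω) :
    R.ev z (R.act φ h) = (φ : Ω →ᵇ ℂ) z * R.ev z h := by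
  refine R.denseRange_incl.induction_on
    (p := fun h => R.ev z (R.act φ h) = (φ : Ω →ᵇ ℂ) z * R.ev z h) h
    (isClosed_eq (by fun_prop) (by fun_prop)) fun f => ?_
  rw [act_incl, ev_incl, ev_incl]
  simp

/-- An element of `H` is determined by its values on `Ω`. -/
theorem ext_ev (R : QuasiFreeModule Ω H) {g h : H} (hgh : ∀ z, R.ev z g = R.ev z h) : g = h := by
  obtain ⟨u, hu, hlim⟩ := mem_closure_iff_seq_limit.1 (R.denseRange_incl (g - h))
  choose f hf using hu
  obtain rfl : (fun k => R.incl (f k)) = u := funext hf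
  have h0 : Tendsto (fun k => R.incl (f k)) atTop (𝓝 0) := by
    refine (R.tendsto_zero_iff f hlim.cauchySeq).2 fun w => ?_
    have := ((R.ev w).continuous.tendsto _).comp hlim
    simpa [Function.comp_def, ev_incl, hgh] using this
  exact sub_eq_zero.1 (tendsto_nhds_unique hlim h0)

/-- The reproducing kernel vector `K(·, z)`. -/
def kernel (R : QuasiFreeModule Ω H) (z : Ω) : H :=
  (InnerProductSpace.toDual ℂ H).symm (R.ev z)

theorem inner_kernel (R : QuasiFreeModule Ω H) (z : Ω) (h : H) :
    inner ℂ (R.kernel z) h = R.ev z h := by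
  simp [kernel]

theorem denseRange_kernel (R : QuasiFreeModule Ω H) :
    DenseRange (Finsupp.linearCombination ℂ R.kernel) := by
  have h : (LinearMap.range (Finsupp.linearCombination ℂ R.kernel)).topologicalClosure = ⊤ := by
    rw [Submodule.topologicalClosure_eq_top_iff, Submodule.eq_bot_iff]
    intro h hh
    refine R.ext_ev fun z => ?_
    rw [map_zero, ← inner_kernel]
    exact hh _ ⟨Finsupp.single z 1, by simp⟩
  have := (Submodule.dense_iff_topologicalClosure_eq_top).2 h
  rwa [LinearMap.coe_range] at this

/-- The dilates `z ↦ φ (r z)`, `0 ≤ r < 1`, of a bounded holomorphic function on the ball belong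
to the ball algebra. -/
theorem exists_dilate {φ : unitBall n →ᵇ ℂ} (hφ : φ ∈ hInfty (unitBall n)) {r : ℝ} (h0 : 0 ≤ r)
    (h1 : r < 1) : ∃ ψ : holoAlgebra (unitBall n), ‖ψ‖ ≤ ‖φ‖ ∧
      ∀ z w : unitBall n, (w : CSpace n) = r • (z : CSpace n) → (ψ : unitBall n →ᵇ ℂ) z = φ w := by
  obtain ⟨g, hg, hφg⟩ := hφ
  have hmaps : ∀ z : CSpace n, ‖z‖ ≤ 1 → r • z ∈ unitBall n := by
    intro z hz
    rw [mem_ball_zero_iff, norm_smul, Real.norm_of_nonneg h0]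
    nlinarith
  let s : C(unitBall n, unitBall n) :=
    ⟨fun z => ⟨r • (z : CSpace n), hmaps z (mem_ball_zero_iff.1 z.2).le⟩, by fun_prop⟩
  refine ⟨⟨φ.compContinuous s, subset_closure ?_⟩, ?_, ?_⟩
  · refine ⟨(fun z : CSpace n => r • z) ⁻¹' unitBall n, fun z => g (r • z),
      isOpen_ball.preimage (by fun_prop), ?_, ?_, fun z => hφg _⟩
    · intro z hz
      refine hmaps z ?_
      simpa using closure_ball_subset_closedBall hz
    · exact hg.comp (by fun_prop) fun z hz => hz
  · exact BoundedContinuousFunction.norm_compContinuous_le φ s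
  · intro z w hw
    change φ (s z) = φ w
    congr 1
    exact Subtype.ext hw.symm

/-- Every `φ ∈ H^∞` of the ball is a multiplier of a contractive quasi-free module of multiplicity
one over the ball algebra: there is exactly one bounded operator `T` with
`(T h)(z) = φ(z) h(z)` for all `h` and `z`. -/
theorem existsUnique_mulOp (R : QuasiFreeModule (unitBall n) H) (hR : R.IsContractive)
    (φ : hInfty (unitBall n)) :
    ∃! T : H →L[ℂ] H, ∀ (h : H) (z : unitBall n),
      R.ev z (T h) = (φ : unitBall n →ᵇ ℂ) z * R.ev z h := by
  refine existsUnique_of_exists_of_unique ?_ fun S T hS hT => ?_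
  swap
  · ext h
    exact R.ext_ev fun z => by rw [hS, hT]
  obtain ⟨φ, hφ⟩ := φ
  set e := Finsupp.linearCombination ℂ R.kernel
  set f := Finsupp.linearCombination ℂ (fun z => conj (φ z) • R.kernel z)
  have key : ∀ c, ‖f c‖ ≤ ‖φ‖ * ‖e c‖ := by
    intro c
    let r : ℕ → ℝ := fun j => 1 - 1 / ((j : ℝ) + 1)
    have hr0 : ∀ j, 0 ≤ r j := fun j => by
      have : 1 / ((j : ℝ) + 1) ≤ 1 := by
        rw [div_le_one (by positivity)]
        linarith [(Nat.cast_nonneg j : (0 : ℝ) ≤ j)]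
      simp only [r]; linarith
    have hr1 : ∀ j, r j < 1 := fun j => by
      have : 0 < 1 / ((j : ℝ) + 1) := by positivity
      simp only [r]; linarith
    have hr : Tendsto r atTop (𝓝 1) := by
      simpa [r] using tendsto_const_nhds.sub (tendsto_one_div_add_atTop_nhds_zero_nat (𝕜 := ℝ))
    choose ψ hψ hψv using fun j => exists_dilate hφ (hr0 j) (hr1 j)
    have hadj : ∀ j z, (R.act (ψ j)).adjoint (R.kernel z) =
        conj ((ψ j : unitBall n →ᵇ ℂ) z) • R.kernel z := by
      intro j z
      refine ext_inner_right ℂ fun h => ?_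
      rw [ContinuousLinearMap.adjoint_inner_left, inner_kernel, ev_act, inner_smul_left,
        inner_kernel]
      simp
    have hsum : ∀ j, (R.act (ψ j)).adjoint (e c) =
        c.sum fun z a => a • conj ((ψ j : unitBall n →ᵇ ℂ) z) • R.kernel z := by
      intro j
      simp [e, Finsupp.linearCombination_apply, Finsupp.sum, map_sum, hadj]
    have hlim : Tendsto (fun j => (R.act (ψ j)).adjoint (e c)) atTop (𝓝 (f c)) := by
      simp only [hsum, f, Finsupp.linearCombination_apply, Finsupp.sum]
      refine tendsto_finsetSum _ fun z _ => ?_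
      refine Tendsto.const_smul (Tendsto.smul_const ?_ _) _
      refine (Complex.continuous_conj.tendsto _).comp ?_
      have hmem : ∀ j, r j • (z : CSpace n) ∈ unitBall n := fun j => by
        have := mem_ball_zero_iff.1 z.2
        rw [mem_ball_zero_iff, norm_smul, Real.norm_of_nonneg (hr0 j)]
        nlinarith [hr1 j, hr0 j, norm_nonneg (z : CSpace n)]
      have hv : ∀ j, (ψ j : unitBall n →ᵇ ℂ) z = φ ⟨r j • (z : CSpace n), hmem j⟩ :=
        fun j => hψv j z _ rfl
      simp only [hv]
      refine (φ.continuous.tendsto z).comp (tendsto_subtype_rng.2 ?_)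
      simpa using hr.smul_const (z : CSpace n)
    refine le_of_tendsto hlim.norm (Eventually.of_forall fun j => ?_)
    refine ((R.act (ψ j)).adjoint.le_opNorm _).trans ?_
    refine mul_le_mul_of_nonneg_right ?_ (norm_nonneg _)
    rw [LinearIsometryEquiv.norm_map]
    exact ContinuousLinearMap.opNorm_le_bound _ (norm_nonneg _) fun h =>
      (hR (ψ j) h).trans (mul_le_mul_of_nonneg_right (hψ j) (norm_nonneg _))
  refine ⟨(f.extendOfNorm e).adjoint, fun h z => ?_⟩
  have hz : f.extendOfNorm e (R.kernel z) = conj (φ z) • R.kernel z := by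
    have := LinearMap.extendOfNorm_eq R.denseRange_kernel ⟨‖φ‖, key⟩ (Finsupp.single z 1)
    simpa [e, f] using this
  rw [← inner_kernel, ContinuousLinearMap.adjoint_inner_right, hz, inner_smul_left, inner_kernel]
  simp

/-- The multiplication operator `M_φ`, `φ ∈ H^∞`, on a contractive quasi-free module of
multiplicity one over the ball algebra. -/
def mulOp (R : QuasiFreeModule (unitBall n) H) (hR : R.IsContractive)
    (φ : hInfty (unitBall n)) : H →L[ℂ] H :=
  (R.existsUnique_mulOp hR φ).choose

theorem ev_mulOp (R : QuasiFreeModule (unitBall n) H) (hR : R.IsContractive)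
    (φ : hInfty (unitBall n)) (h : H) (z : unitBall n) :
    R.ev z (R.mulOp hR φ h) = (φ : unitBall n →ᵇ ℂ) z * R.ev z h :=
  (R.existsUnique_mulOp hR φ).choose_spec.1 h z

end QuasiFreeModule

/-- A tuple of operators on `H` is semi-Fredholm if the last cohomology group
`H / (T₁ H + ⋯ + T_k H)` of its Koszul complex is finite dimensional. -/
def IsSemiFredholm {k : ℕ} {H : Type*} [NormedAddCommGroup H] [InnerProductSpace ℂ H]
    (T : Fin k → H →L[ℂ] H) : Prop :=
  FiniteDimensional ℂ (H ⧸ ⨆ i, LinearMap.range (T i : H →ₗ[ℂ] H))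

/-- The weak corona property of a tuple of scalar functions on the unit ball. -/
def HasWeakCorona {n k : ℕ} (φ : Fin k → hInfty (unitBall n)) : Prop :=
  ∃ ε : ℝ, 0 < ε ∧ ∃ δ : ℝ, 0 < δ ∧ δ < 1 ∧ ∀ z : unitBall n, 1 - δ ≤ ‖(z : CSpace n)‖ →
    ε ≤ ∑ i, ‖(φ i : unitBall n →ᵇ ℂ) z‖ ^ 2

end

/-! ### Kernel vectors and weak convergence -/

namespace QuasiFreeModule

variable {n : ℕ} {Ω : Set (CSpace n)} {H : Type*} [NormedAddCommGroup H]
  [InnerProductSpace ℂ H] [CompleteSpace H]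

/-! The normalized kernels `k_z` are joint eigenvectors of the adjoints, `M_φ^* k_z = conj (φ z)
k_z`. If the corona property fails, some `z j` tend to the sphere with all `φ i (z j) → 0`. The open
mapping theorem (`IsSemiFredholm.exists_bounded_decomposition`) splits `k_{z j}` as `∑ M_{φ i} (g j
i) + f j`, with bounded `g j i` and with `f j` bounded in a fixed finite dimensional space. Pairing
with `k_{z j}` itself gives 1 on the left. On the right the range part vanishes by the eigenvector
relation, and the finite dimensional part because `k_{z j} → 0` weakly: a contradiction.

The weak convergence (`tendsto_inner_normalizedKernel`) is where contractivity enters. Let `E` be a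
weak limit of `k_{z j}` with `z j → ζ`, and let `p` peak at `ζ`. Then `E (p ^ m) = E 1` for every
`m`, while `p ^ m → 0` weakly, so `E 1 = 0`. This says that `‖K_{z j}‖ → ∞`, and `E` then vanishes
on the ball algebra, which is dense. -/

theorem kernel_ne_zero (R : QuasiFreeModule Ω H) (z : Ω) : R.kernel z ≠ 0 := by
  intro h
  have h1 := R.inner_kernel z (R.incl 1)
  rw [h, inner_zero_left, ev_incl] at h1
  simp at h1

/-- Contractivity applied to the vector `1`; it keeps the powers of a peak function bounded in the
module. -/
theorem norm_incl_le (R : QuasiFreeModule Ω H) (hR : R.IsContractive) (f : holoAlgebra Ω) :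
    ‖R.incl f‖ ≤ ‖f‖ * ‖R.incl 1‖ := by
  have h := hR f (R.incl 1)
  rwa [act_incl, mul_one] at h

/-- A sequence in the module that is bounded in norm and tends to `0` pointwise tends to `0`
weakly. -/
theorem tendsto_inner_of_bounded_of_tendsto_ev (R : QuasiFreeModule Ω H) {x : ℕ → H} {C : ℝ}
    (hC : ∀ m, ‖x m‖ ≤ C) (hx : ∀ z, Tendsto (fun m => R.ev z (x m)) atTop (𝓝 0)) (u : H) :
    Tendsto (fun m => inner ℂ u (x m)) atTop (𝓝 0) := by
  have hC0 : 0 ≤ C := (norm_nonneg _).trans (hC 0)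
  rw [Metric.tendsto_atTop]
  intro ε hε
  -- Combinations of kernels are dense, and against them the claim is pointwise convergence.
  -- Dividing by `C + 1` allows for `C = 0`.
  obtain ⟨c, hc⟩ := R.denseRange_kernel.exists_dist_lt u (ε := ε / (2 * (C + 1))) (by positivity)
  set v := Finsupp.linearCombination ℂ R.kernel c with hv
  have hlim : Tendsto (fun m => inner ℂ v (x m)) atTop (𝓝 0) := by
    simp only [hv, Finsupp.linearCombination_apply, Finsupp.sum, sum_inner, inner_smul_left,
      inner_kernel]
    simpa using tendsto_finsetSum c.support fun z _ => (hx z).const_mul (conj (c z))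
  obtain ⟨N, hN⟩ := Metric.tendsto_atTop.1 hlim (ε / 2) (by positivity)
  refine ⟨N, fun m hm => ?_⟩
  have h1 := hN m hm
  rw [dist_zero_right] at h1 ⊢
  have h2 : ‖inner ℂ (u - v) (x m)‖ ≤ ε / 2 := by
    refine (norm_inner_le_norm _ _).trans ?_
    rw [dist_eq_norm] at hc
    calc ‖u - v‖ * ‖x m‖ ≤ ε / (2 * (C + 1)) * (C + 1) := by
          gcongr
          linarith [hC m]
      _ = ε / 2 := by field_simp
  calc ‖inner ℂ u (x m)‖ = ‖inner ℂ (u - v) (x m) + inner ℂ v (x m)‖ := by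
        rw [← inner_add_left, sub_add_cancel]
    _ ≤ _ := norm_add_le _ _
    _ < ε := by linarith

/-! ### Peak functions -/

/-- Cauchy–Schwarz; strictness makes the powers of the peak function tend to `0` at each point of
the ball. -/
theorem norm_peak_lt_one {ζ : CSpace n} (hζ : ‖ζ‖ = 1) (z : unitBall n) :
    ‖(1 + inner ℂ ζ (z : CSpace n)) / 2‖ < 1 := by
  have h1 := norm_inner_le_norm (𝕜 := ℂ) ζ (z : CSpace n)
  have h2 := mem_ball_zero_iff.1 z.2
  have h3 := norm_add_le (1 : ℂ) (inner ℂ ζ (z : CSpace n))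
  rw [hζ, one_mul] at h1
  rw [norm_one] at h3
  rw [norm_div, Complex.norm_ofNat]
  linarith

/-- The function `z ↦ (1 + ⟪ζ, z⟫) / 2` of the ball algebra, which peaks at the boundary
point `ζ`. -/
theorem exists_peak {ζ : CSpace n} (hζ : ‖ζ‖ = 1) :
    ∃ p : holoAlgebra (unitBall n), ‖p‖ ≤ 1 ∧
      ∀ z : unitBall n, (p : unitBall n →ᵇ ℂ) z = (1 + inner ℂ ζ (z : CSpace n)) / 2 := by
  have hb := fun z => (norm_peak_lt_one hζ z).le
  let p : unitBall n →ᵇ ℂ := BoundedContinuousFunction.ofNormedAddCommGroup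
    (fun z : unitBall n => (1 + inner ℂ ζ (z : CSpace n)) / 2) (by fun_prop) 1 hb
  refine ⟨⟨p, subset_closure ⟨Set.univ, fun z => (1 + inner ℂ ζ z) / 2, isOpen_univ,
    Set.subset_univ _, ?_, fun z => rfl⟩⟩, ?_, fun z => rfl⟩
  · have : Differentiable ℂ fun z : CSpace n => inner ℂ ζ z := (innerSL ℂ ζ).differentiable
    simp only [div_eq_mul_inv]
    exact ((this.const_add (1 : ℂ)).mul_const (2 : ℂ)⁻¹).differentiableOn
  · exact (BoundedContinuousFunction.norm_le zero_le_one).2 hb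

/-! ### Weak convergence of normalized kernels at the boundary -/

/-- The normalized kernel vector at `z`. -/
noncomputable def normalizedKernel (R : QuasiFreeModule Ω H) (z : Ω) : H :=
  (‖R.kernel z‖⁻¹ : ℂ) • R.kernel z

theorem norm_normalizedKernel (R : QuasiFreeModule Ω H) (z : Ω) :
    ‖R.normalizedKernel z‖ = 1 := by
  have := norm_ne_zero_iff.2 (R.kernel_ne_zero z)
  simp [normalizedKernel, norm_smul, this]

theorem inner_normalizedKernel (R : QuasiFreeModule Ω H) (z : Ω) (h : H) :
    inner ℂ (R.normalizedKernel z) h = (‖R.kernel z‖⁻¹ : ℂ) * R.ev z h := by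
  simp [normalizedKernel, inner_kernel, mul_comm]

/-- In a contractive module over the ball algebra the normalized kernel vectors tend weakly to `0`
at the boundary. -/
theorem tendsto_inner_normalizedKernel (R : QuasiFreeModule (unitBall n) H)
    (hR : R.IsContractive) {ι : Type*} (l : Ultrafilter ι) (z : ι → unitBall n)
    (hz : Tendsto (fun j => ‖(z j : CSpace n)‖) l (𝓝 1)) (h : H) :
    Tendsto (fun j => inner ℂ (R.normalizedKernel (z j)) h) l (𝓝 0) := by
  obtain ⟨ζ, -, hζ⟩ := (isCompact_closedBall (0 : CSpace n) 1).ultrafilter_le_nhds'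
    (l.map fun j => (z j : CSpace n)) (Ultrafilter.mem_map.2 (Eventually.of_forall fun j =>
      ball_subset_closedBall (z j).2))
  replace hζ : Tendsto (fun j => (z j : CSpace n)) l (𝓝 ζ) := hζ
  have hζ1 : ‖ζ‖ = 1 := tendsto_nhds_unique hζ.norm hz
  -- The weak limit of the normalized kernels along the ultrafilter.
  let e : ι → WeakDual ℂ H := fun j =>
    StrongDual.toWeakDual (InnerProductSpace.toDual ℂ H (R.normalizedKernel (z j)))
  obtain ⟨E, -, hE⟩ := (WeakDual.isCompact_closedBall (𝕜 := ℂ) (E := H) 0 1).ultrafilter_le_nhds'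
    (l.map e) (Ultrafilter.mem_map.2 (Eventually.of_forall fun j => by
      simp [e, norm_normalizedKernel]))
  replace hE : Tendsto e l (𝓝 E) := hE
  have hE' : ∀ h, Tendsto (fun j => inner ℂ (R.normalizedKernel (z j)) h) l (𝓝 (E h)) :=
    fun h => ((WeakDual.eval_continuous h).tendsto E).comp hE
  -- Pairing with the constant function `1` leaves only the normalizing factor.
  have hc : Tendsto (fun j => (‖R.kernel (z j)‖⁻¹ : ℂ)) l (𝓝 (E (R.incl 1))) := by
    simpa [inner_normalizedKernel, ev_incl] using hE' (R.incl 1)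
  obtain ⟨p, hp1, hp⟩ := exists_peak hζ1
  have hpz : Tendsto (fun j => (p : unitBall n →ᵇ ℂ) (z j)) l (𝓝 1) := by
    have : Tendsto (fun j => (1 + inner ℂ ζ (z j : CSpace n)) / 2) l
        (𝓝 ((1 + inner ℂ ζ ζ) / 2)) :=
      ((tendsto_const_nhds.inner hζ).const_add 1).div_const 2
    simp only [hp]
    convert this using 2
    rw [inner_self_eq_norm_sq_to_K, hζ1]
    norm_num
  have hconst : ∀ m : ℕ, E (R.incl (p ^ m)) = E (R.incl 1) := by
    intro m
    refine tendsto_nhds_unique (hE' _) ?_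
    simpa [inner_normalizedKernel, ev_incl] using hc.mul (hpz.pow m)
  have hpow : ∀ m : ℕ, ‖p ^ m‖ ≤ 1 := by
    intro m
    refine (BoundedContinuousFunction.norm_le zero_le_one).2 fun w => ?_
    have h1 : ‖(p : unitBall n →ᵇ ℂ) w‖ ≤ 1 :=
      ((p : unitBall n →ᵇ ℂ).norm_coe_le_norm w).trans hp1
    simpa using pow_le_one₀ (norm_nonneg _) h1
  have hweak := R.tendsto_inner_of_bounded_of_tendsto_ev (x := fun m => R.incl (p ^ m))
    (C := ‖R.incl 1‖)
    (fun m => (R.norm_incl_le hR _).trans (mul_le_of_le_one_left (norm_nonneg _) (hpow m)))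
    (fun w => by
      simp only [ev_incl]
      have := tendsto_pow_atTop_nhds_zero_of_norm_lt_one (norm_peak_lt_one hζ1 w)
      simpa [hp] using this)
    ((InnerProductSpace.toDual ℂ H).symm (WeakDual.toStrongDual E))
  have hc0 : E (R.incl 1) = 0 := by
    refine tendsto_nhds_unique ?_ hweak
    simp only [InnerProductSpace.toDual_symm_apply]
    change Tendsto (fun m => E (R.incl (p ^ m))) _ _
    simp only [hconst]
    exact tendsto_const_nhds
  -- Elements of the algebra are bounded functions, so the vanishing factor `‖K‖⁻¹` kills their
  -- pairings.
  have hE0 : ∀ h, E h = 0 := by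
    intro h
    refine R.denseRange_incl.induction_on (p := fun h => E h = 0) h
      (isClosed_eq (map_continuous (WeakDual.toStrongDual E)) continuous_const) fun f => ?_
    refine tendsto_nhds_unique (hE' _) ?_
    rw [hc0] at hc
    refine squeeze_zero_norm (a := fun j => ‖(‖R.kernel (z j)‖⁻¹ : ℂ)‖ * ‖f‖) (fun j => ?_) ?_
    · rw [inner_normalizedKernel, ev_incl, norm_mul]
      gcongr
      exact (f : unitBall n →ᵇ ℂ).norm_coe_le_norm _
    · have := hc.norm.mul_const ‖f‖
      rwa [norm_zero, zero_mul] at this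
  simpa [hE0] using hE' h

/-- The eigenvector relation for `M_φ^*`, written without the adjoint. -/
theorem inner_normalizedKernel_mulOp (R : QuasiFreeModule (unitBall n) H) (hR : R.IsContractive)
    (φ : hInfty (unitBall n)) (z : unitBall n) (h : H) :
    inner ℂ (R.normalizedKernel z) (R.mulOp hR φ h) =
      (φ : unitBall n →ᵇ ℂ) z * inner ℂ (R.normalizedKernel z) h := by
  rw [inner_normalizedKernel, inner_normalizedKernel, ev_mulOp]
  ring

end QuasiFreeModule

/-! ### Bounded decomposition for semi-Fredholm tuples -/

/-- For a semi-Fredholm tuple `T` every vector is, with norm control, a sum of an element of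
`T₁ H + ⋯ + T_k H` and an element of a fixed finite dimensional space. -/
theorem IsSemiFredholm.exists_bounded_decomposition {k : ℕ} {H : Type*} [NormedAddCommGroup H]
    [InnerProductSpace ℂ H] [CompleteSpace H] {T : Fin k → H →L[ℂ] H} (hT : IsSemiFredholm T) :
    ∃ F : Submodule ℂ H, FiniteDimensional ℂ F ∧ ∃ C : ℝ, ∀ h : H, ∃ (g : Fin k → H) (f : F),
      h = ∑ i, T i (g i) + f ∧ (∀ i, ‖g i‖ ≤ C * ‖h‖) ∧ ‖f‖ ≤ C * ‖h‖ := by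
  obtain ⟨F, hF⟩ := Submodule.exists_isCompl (⨆ i, LinearMap.range (T i : H →ₗ[ℂ] H))
  unfold IsSemiFredholm at hT
  have hfin : FiniteDimensional ℂ F :=
    (Submodule.quotientEquivOfIsCompl _ F hF).finiteDimensional
  -- An algebraic complement `F` suffices: being finite dimensional, it is complete, so the open
  -- mapping theorem applies to `S` without first showing that the range is closed.
  let S : ((Fin k → H) × F) →L[ℂ] H :=
    (∑ i, (T i).comp (ContinuousLinearMap.proj i)).coprod F.subtypeL
  have hS : ∀ x, S x = ∑ i, T i (x.1 i) + x.2 := by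
    intro x
    simp [S]
  have hsurj : Function.Surjective S := by
    intro h
    have hmem : h ∈ (⨆ i, LinearMap.range (T i : H →ₗ[ℂ] H)) ⊔ F := by
      rw [hF.sup_eq_top]; trivial
    obtain ⟨y, hy, f, hf, rfl⟩ := Submodule.mem_sup.1 hmem
    obtain ⟨μ, hμ, rfl⟩ := (Submodule.mem_iSup_iff_exists_finsupp _ _).1 hy
    choose g hg using hμ
    refine ⟨(g, ⟨f, hf⟩), ?_⟩
    rw [hS, Finsupp.sum_fintype _ _ (fun _ => rfl)]
    congr 1
    exact Finset.sum_congr rfl fun i _ => hg i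
  obtain ⟨C, -, hC⟩ := S.exists_preimage_norm_le hsurj
  refine ⟨F, hfin, C, fun h => ?_⟩
  obtain ⟨x, hx, hxC⟩ := hC h
  refine ⟨x.1, x.2, by rw [← hS, hx], fun i => ?_, (norm_snd_le x).trans hxC⟩
  exact (norm_le_pi_norm x.1 i).trans ((norm_fst_le x).trans hxC)

/-! ### The contradiction along a boundary sequence -/

theorem mainTheorem8 {n : ℕ} (hn : 1 ≤ n) {H : Type*} [NormedAddCommGroup H]
    [InnerProductSpace ℂ H] [CompleteSpace H]
    (R : QuasiFreeModule (unitBall n) H) (hR : R.IsContractive)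
    {k : ℕ} (φ : Fin k → hInfty (unitBall n))
    (hφ : IsSemiFredholm fun i => R.mulOp hR (φ i)) :
    HasWeakCorona φ := by
  by_contra hcon
  unfold HasWeakCorona at hcon
  push Not at hcon
  -- The same `1 / (j + 2)` serves as `ε` and `δ`; the shift by 2 keeps `δ < 1` at `j = 0`.
  have hpos : ∀ j : ℕ, 0 < 1 / ((j : ℝ) + 2) := fun j => by positivity
  have hlt : ∀ j : ℕ, 1 / ((j : ℝ) + 2) < 1 := fun j => by
    rw [div_lt_one (by positivity)]
    linarith [(Nat.cast_nonneg j : (0 : ℝ) ≤ j)]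
  have hlim : Tendsto (fun j : ℕ => 1 / ((j : ℝ) + 2)) atTop (𝓝 0) :=
    tendsto_const_nhds.div_atTop (tendsto_natCast_atTop_atTop.atTop_add tendsto_const_nhds)
  choose z hz hzφ using fun j : ℕ => hcon _ (hpos j) _ (hpos j) (hlt j)
  -- Limits along a nonprincipal ultrafilter replace passing to subsequences.
  let l : Ultrafilter ℕ := Filter.hyperfilter ℕ
  have hl : (l : Filter ℕ) ≤ atTop := Nat.hyperfilter_le_atTop
  have hz1 : Tendsto (fun j => ‖(z j : CSpace n)‖) l (𝓝 1) := by
    refine Tendsto.mono_left (tendsto_of_tendsto_of_tendsto_of_le_of_le (h := fun _ => (1 : ℝ)) ?_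
      tendsto_const_nhds hz fun j => (mem_ball_zero_iff.1 (z j).2).le) hl
    simpa using hlim.const_sub 1
  have hφ0 : ∀ i, Tendsto (fun j => (φ i : unitBall n →ᵇ ℂ) (z j)) l (𝓝 0) := by
    intro i
    have hsq : Tendsto (fun j => ‖(φ i : unitBall n →ᵇ ℂ) (z j)‖ ^ 2) l (𝓝 0) :=
      squeeze_zero (fun j => by positivity) (fun j => (Finset.single_le_sum
        (f := fun i => ‖(φ i : unitBall n →ᵇ ℂ) (z j)‖ ^ 2) (fun _ _ => by positivity)
        (Finset.mem_univ i)).trans (hzφ j).le) (hlim.mono_left hl)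
    rw [tendsto_zero_iff_norm_tendsto_zero]
    simpa [Real.sqrt_sq] using hsq.sqrt
  obtain ⟨F, hF, C, hC⟩ := hφ.exists_bounded_decomposition
  set u := fun j => R.normalizedKernel (z j) with hu
  have hu1 : ∀ j, ‖u j‖ = 1 := fun j => R.norm_normalizedKernel (z j)
  choose g f hgf hg hf using fun j => hC (u j)
  simp only [hu1, mul_one] at hg hf
  have hw := R.tendsto_inner_normalizedKernel hR l z hz1
  have : ProperSpace F := FiniteDimensional.proper ℂ F
  obtain ⟨f₀, -, hf₀⟩ := (isCompact_closedBall (0 : F) C).ultrafilter_le_nhds' (l.map f)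
    (Ultrafilter.mem_map.2 (Eventually.of_forall fun j => mem_closedBall_zero_iff.2 (hf j)))
  replace hf₀ : Tendsto f l (𝓝 f₀) := hf₀
  -- Norm convergence of `f j` reduces this to pairing the weakly null `u j` with the fixed vector
  -- `f₀`.
  have hfin : Tendsto (fun j => inner ℂ (u j) (f j : H)) l (𝓝 0) := by
    have h1 : Tendsto (fun j => inner ℂ (u j) ((f j : H) - f₀)) l (𝓝 0) := by
      refine squeeze_zero_norm (a := fun j => ‖f j - f₀‖) (fun j => ?_) ?_
      · refine (norm_inner_le_norm _ _).trans ?_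
        rw [hu1, one_mul]
        rfl
      · simpa using (hf₀.sub_const f₀).norm
    have h2 := h1.add (hw f₀)
    rw [add_zero] at h2
    exact h2.congr fun j => by rw [← inner_add_right, sub_add_cancel]
  have hrange : Tendsto (fun j => ∑ i, inner ℂ (u j) (R.mulOp hR (φ i) (g j i))) l (𝓝 0) := by
    rw [← Finset.sum_const_zero (s := (Finset.univ : Finset (Fin k)))]
    refine tendsto_finsetSum _ fun i _ => ?_
    refine squeeze_zero_norm (a := fun j => ‖(φ i : unitBall n →ᵇ ℂ) (z j)‖ * C) (fun j => ?_) ?_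
    · rw [hu, R.inner_normalizedKernel_mulOp, norm_mul]
      gcongr
      refine (norm_inner_le_norm _ _).trans ?_
      rw [R.norm_normalizedKernel, one_mul]
      exact hg j i
    · simpa using (hφ0 i).norm.mul_const C
  have hone : ∀ j, (1 : ℂ) = ∑ i, inner ℂ (u j) (R.mulOp hR (φ i) (g j i)) +
      inner ℂ (u j) (f j : H) := by
    intro j
    rw [← inner_sum, ← inner_add_right, ← hgf j, inner_self_eq_norm_sq_to_K, hu1]
    norm_num
  have h10 : Tendsto (fun _ : ℕ => (1 : ℂ)) l (𝓝 0) := by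
    have := hrange.add hfin
    rw [add_zero] at this
    exact this.congr fun j => (hone j).symm
  exact one_ne_zero (tendsto_nhds_unique tendsto_const_nhds h10)
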